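/- Let $k\ge 0$ be an integer with $k\neq 1$, and let $\mathbb R^{p,q}$ denote $\mathbb R^{p+q}$ with the symmetric bilinear form $\mathrm{diag}(1,\dots,1,-1,\dots,-1)$ ($p$ plus signs, $q$ minus signs). Let $SO(p,q)\subset SL(p+q,\mathbb R)$ be the group of determinant-one linear maps preserving this form, and let $SO^+(p,q)$ be its identity component. Put $G=SO^+(3,k)$. Fix any orthogonal decomposition $\mathbb R^{3,k}=W\oplus W^\perp$ with $W$ a positive definite plane, together with isometries $W\cong\mathbb R^{2,0}$ and $W^\perp\cong\mathbb R^{1,k}$, and let $H\cong SO(2)\times SO^+(1,k)$ be the subgroup of $G$ consisting of the maps $A\oplus B$ with $A\in SO(2)$ acting on $W$ and $B\in SO^+(1,k)$ acting on $W^\perp$. Then every closed connected subgroup $S$ of $G$ which contains $H$ is equal to $G$ or to $H$. -/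

import Mathlib

open Matrix

/-- The special orthogonal group `SO(p,q)`: real matrices of determinant one which preserve the
symmetric bilinear form `diag(1,…,1,-1,…,-1)` with `p` plus signs and `q` minus signs. -/
def indefSO (p q : ℕ) : Subgroup (SpecialLinearGroup (Fin p ⊕ Fin q) ℝ) where
  carrier := {A | (A : Matrix (Fin p ⊕ Fin q) (Fin p ⊕ Fin q) ℝ)ᵀ *
    LieAlgebra.Orthogonal.indefiniteDiagonal (Fin p) (Fin q) ℝ * A =
      LieAlgebra.Orthogonal.indefiniteDiagonal (Fin p) (Fin q) ℝ}
  one_mem' := by simp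
  mul_mem' := by
    intro A B hA hB
    change (A.1 * B.1)ᵀ * _ * (A.1 * B.1) = _
    have hA' : A.1ᵀ * LieAlgebra.Orthogonal.indefiniteDiagonal (Fin p) (Fin q) ℝ * A.1 =
      LieAlgebra.Orthogonal.indefiniteDiagonal (Fin p) (Fin q) ℝ := hA
    have hB' : B.1ᵀ * LieAlgebra.Orthogonal.indefiniteDiagonal (Fin p) (Fin q) ℝ * B.1 =
      LieAlgebra.Orthogonal.indefiniteDiagonal (Fin p) (Fin q) ℝ := hB
    rw [transpose_mul]
    calc _ = B.1ᵀ * (A.1ᵀ *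
          LieAlgebra.Orthogonal.indefiniteDiagonal (Fin p) (Fin q) ℝ * A.1) * B.1 := by
            simp only [Matrix.mul_assoc]
      _ = _ := by rw [hA', hB']
  inv_mem' := by
    intro A hA
    have hA' : A.1ᵀ * LieAlgebra.Orthogonal.indefiniteDiagonal (Fin p) (Fin q) ℝ * A.1 =
      LieAlgebra.Orthogonal.indefiniteDiagonal (Fin p) (Fin q) ℝ := hA
    change A⁻¹.1ᵀ * _ * A⁻¹.1 = _
    have h1 : A.1 * A⁻¹.1 = 1 := congrArg Subtype.val (mul_inv_cancel A)
    have h2 : A⁻¹.1ᵀ * A.1ᵀ = 1 := by rw [← transpose_mul, h1, transpose_one]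
    nth_rewrite 1 [← hA']
    calc _ = (A⁻¹.1ᵀ * A.1ᵀ) * LieAlgebra.Orthogonal.indefiniteDiagonal (Fin p) (Fin q) ℝ *
          (A.1 * A⁻¹.1) := by
            simp only [Matrix.mul_assoc]
      _ = _ := by rw [h1, h2, Matrix.one_mul, Matrix.mul_one]

/-- `SO⁺(p,q)`: the connected component of the identity of the topological group `SO(p,q)`,
regarded as a subgroup of `SL(p+q,ℝ)`. -/
def indefSOPlus (p q : ℕ) : Subgroup (SpecialLinearGroup (Fin p ⊕ Fin q) ℝ) :=
  (Subgroup.connectedComponentOfOne (indefSO p q)).map (indefSO p q).subtype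

/-- An isometric splitting `ℝ^{2,0} ⊕ ℝ^{1,k} ≅ ℝ^{3,k}`, given by its matrix `P`: the first two
columns of `P` are an orthonormal basis of a positive definite plane `W`, and the other `1 + k`
columns are an orthonormal basis (with signs `+,-,…,-`) of the orthogonal complement of `W`. -/
def IsPlaneSplitting (k : ℕ) (P : Matrix (Fin 3 ⊕ Fin k) (Fin 2 ⊕ (Fin 1 ⊕ Fin k)) ℝ) : Prop :=
  Pᵀ * LieAlgebra.Orthogonal.indefiniteDiagonal (Fin 3) (Fin k) ℝ * P =
    fromBlocks 1 0 0 (LieAlgebra.Orthogonal.indefiniteDiagonal (Fin 1) (Fin k) ℝ)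

/-- The image of `SO(2) × SO⁺(1,k)` in `SL(3+k,ℝ)` under the splitting `P`: the elements `M`
which act on `ℝ^{3,k} ≅ ℝ^{2,0} ⊕ ℝ^{1,k}` as `A ⊕ B` with `A ∈ SO(2)` and `B ∈ SO⁺(1,k)`. -/
def planeSubgroup (k : ℕ) (P : Matrix (Fin 3 ⊕ Fin k) (Fin 2 ⊕ (Fin 1 ⊕ Fin k)) ℝ) :
    Subgroup (SpecialLinearGroup (Fin 3 ⊕ Fin k) ℝ) where
  carrier := {M | ∃ A ∈ specialOrthogonalGroup (Fin 2) ℝ, ∃ B ∈ indefSOPlus 1 k,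
    (M : Matrix (Fin 3 ⊕ Fin k) (Fin 3 ⊕ Fin k) ℝ) * P =
      P * fromBlocks A 0 0 (B : Matrix (Fin 1 ⊕ Fin k) (Fin 1 ⊕ Fin k) ℝ)}
  one_mem' := ⟨1, one_mem _, 1, one_mem _, by simp⟩
  mul_mem' := by
    rintro M N ⟨A, hA, B, hB, h⟩ ⟨A', hA', B', hB', h'⟩
    refine ⟨A * A', mul_mem hA hA', B * B', mul_mem hB hB', ?_⟩
    change M.1 * N.1 * P = P * fromBlocks (A * A') 0 0 (B.1 * B'.1)
    rw [Matrix.mul_assoc, h', ← Matrix.mul_assoc, h, Matrix.mul_assoc, fromBlocks_multiply]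
    simp
  inv_mem' := by
    rintro M ⟨A, hA, B, hB, h⟩
    obtain ⟨A', hA', hA1⟩ : ∃ A' ∈ specialOrthogonalGroup (Fin 2) ℝ, A * A' = 1 :=
      ⟨_, (⟨A, hA⟩⁻¹ : specialOrthogonalGroup (Fin 2) ℝ).2,
        congrArg Subtype.val (mul_inv_cancel (⟨A, hA⟩ : specialOrthogonalGroup (Fin 2) ℝ))⟩
    have hB1 : B.1 * B⁻¹.1 = 1 := congrArg Subtype.val (mul_inv_cancel B)
    have hM1 : M⁻¹.1 * M.1 = 1 := congrArg Subtype.val (inv_mul_cancel M)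
    refine ⟨A', hA', B⁻¹, inv_mem hB, ?_⟩
    have hD : fromBlocks A 0 0 B.1 * fromBlocks A' 0 0 B⁻¹.1 = 1 := by
      rw [fromBlocks_multiply]
      simp only [Matrix.mul_zero, Matrix.zero_mul, add_zero, zero_add, hA1, hB1, fromBlocks_one]
    calc M⁻¹.1 * P = M⁻¹.1 * (P * (fromBlocks A 0 0 B.1 * fromBlocks A' 0 0 B⁻¹.1)) := by
            rw [hD, Matrix.mul_one]
      _ = M⁻¹.1 * M.1 * (P * fromBlocks A' 0 0 B⁻¹.1) := by
            rw [← Matrix.mul_assoc P, ← h]; simp only [Matrix.mul_assoc]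
      _ = _ := by rw [hM1, Matrix.one_mul]

open Matrix
open Filter Topology NormedSpace

/-! ### Exponentials and tangent vectors of closed submonoids of a Banach algebra. -/

section BanachAlgebra

variable {𝔸 : Type*} [NormedRing 𝔸] [NormedAlgebra ℝ 𝔸] [CompleteSpace 𝔸]

/-! Split `𝔰𝔬(3,k) = 𝔥 ⊕ 𝔪` into block diagonal and off-diagonal parts. An element of `𝔪` is
determined by its upper right block `b`, a `2 × (1+k)` matrix, and `𝔥` acts by `b ↦ A b - b D`. For
`1 + k ≠ 2` this module is irreducible (`eq_top_of_invariant`); for `k = 1` the null lines of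
`ℝ^{1,1}` would give invariant subspaces.

The tangent vectors of `S` form a bracket-closed space containing `𝔥`. If it meets `𝔪` nontrivially,
irreducibility makes it all of `𝔰𝔬(3,k)`, so `S` contains a neighbourhood of `1` in `SO(3,k)`, hence
the identity component. Otherwise `S` lies in `exp 𝔥 ⊆ H` near `1`, and `S = H` by connectedness.

The dichotomy is `eventually_mem_exp_or_exists_tangent`, the part of the closed subgroup theorem
needed here: elements of `S` near `1` with logarithm outside `𝔥` produce, after removing the
`𝔥`-part and rescaling, a tangent vector in `𝔪`. Passing to the basis given by `P` turns `S` into a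
submonoid of a matrix algebra, where this applies. -/

theorem continuous_exp_of_real : Continuous (exp : 𝔸 → 𝔸) :=
  let _ : NormedAlgebra ℚ 𝔸 := NormedAlgebra.restrictScalars ℚ ℝ 𝔸
  exp_continuous

theorem exp_mul_exp_neg_of_real (x : 𝔸) : exp x * exp (-x) = 1 := by
  let _ : NormedAlgebra ℚ 𝔸 := NormedAlgebra.restrictScalars ℚ ℝ 𝔸
  rw [← exp_add_of_commute (Commute.refl x).neg_right, add_neg_cancel, exp_zero]

theorem exp_neg_mul_exp_of_real (x : 𝔸) : exp (-x) * exp x = 1 := by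
  simpa using exp_mul_exp_neg_of_real (-x)

theorem exp_pow_of_real (x : 𝔸) (n : ℕ) : exp x ^ n = exp ((n : ℝ) • x) := by
  let _ : NormedAlgebra ℚ 𝔸 := NormedAlgebra.restrictScalars ℚ ℝ 𝔸
  rw [← NormedSpace.exp_nsmul, Nat.cast_smul_eq_nsmul]

theorem exp_conj_of_real {g g' : 𝔸} (h : g * g' = 1) (h' : g' * g = 1) (x : 𝔸) :
    exp (g * x * g') = g * exp x * g' := by
  let _ : NormedAlgebra ℚ 𝔸 := NormedAlgebra.restrictScalars ℚ ℝ 𝔸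
  exact exp_units_conj ⟨g, g', h, h'⟩ x

/-- A local inverse at `1` of the exponential of a real Banach algebra. -/
theorem exists_local_log : ∃ L : 𝔸 → 𝔸, L 1 = 0 ∧
    HasFDerivAt L (ContinuousLinearMap.id ℝ 𝔸) 1 ∧
    (∀ᶠ a in 𝓝 (1 : 𝔸), exp (L a) = a) ∧ ∀ᶠ x in 𝓝 (0 : 𝔸), L (exp x) = x := by
  have h : HasStrictFDerivAt (exp : 𝔸 → 𝔸)
      ((ContinuousLinearEquiv.refl ℝ 𝔸 : 𝔸 ≃L[ℝ] 𝔸) : 𝔸 →L[ℝ] 𝔸) 0 :=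
    hasStrictFDerivAt_exp_zero
  refine ⟨h.localInverse, ?_, ?_, ?_, h.eventually_left_inverse⟩
  · simpa using h.localInverse_apply_image
  · simpa using h.to_localInverse.hasFDerivAt
  · simpa using h.eventually_right_inverse

/-- Since `log a = (a - 1) + o(a - 1)` near `1`, the logarithm of `A n` is `ε n • X + o(ε n)`;
multiplying by `m n` gives `t • X` in the limit. -/
theorem tendsto_pow_exp_of_tendsto {A : ℕ → 𝔸} {ε : ℕ → ℝ} {m : ℕ → ℕ} {X : 𝔸} {t : ℝ}
    (hε0 : ∀ n, 0 < ε n) (hε : Tendsto ε atTop (𝓝 0))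
    (hm : Tendsto (fun n => m n * ε n) atTop (𝓝 t))
    (hA : Tendsto (fun n => (ε n)⁻¹ • (A n - 1)) atTop (𝓝 X)) :
    Tendsto (fun n => A n ^ m n) atTop (𝓝 (exp (t • X))) := by
  obtain ⟨L, hL1, hL, hLe, -⟩ := exists_local_log (𝔸 := 𝔸)
  have hA1 : Tendsto A atTop (𝓝 1) := by
    have h := (hε.smul hA).add_const 1
    rw [zero_smul, zero_add] at h
    refine h.congr fun n => ?_
    rw [smul_inv_smul₀ (hε0 n).ne', sub_add_cancel]
  have hlog : Tendsto (fun n => (ε n)⁻¹ • L (A n)) atTop (𝓝 X) := by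
    have h1 : (fun n => L (A n) - (A n - 1)) =o[atTop] fun n => A n - 1 := by
      simpa [hL1, Function.comp_def] using hL.isLittleO.comp_tendsto hA1
    have h2 : (fun n => (ε n)⁻¹ • (L (A n) - (A n - 1))) =o[atTop]
        fun n => (ε n)⁻¹ • (A n - 1) :=
      (Asymptotics.isBigO_refl (fun n => (ε n)⁻¹) atTop).smul_isLittleO h1
    have h4 := hA.add ((Asymptotics.isLittleO_one_iff ℝ).1 (h2.trans_isBigO (hA.isBigO_one ℝ)))
    rw [add_zero] at h4
    refine h4.congr fun n => ?_
    rw [← smul_add, add_sub_cancel]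
  have h5 := (continuous_exp_of_real.tendsto _).comp (hm.smul hlog)
  refine h5.congr' ?_
  filter_upwards [hA1.eventually hLe] with n hn
  simp only [Function.comp_apply]
  rw [mul_smul, smul_inv_smul₀ (hε0 n).ne', ← exp_pow_of_real, hn]

/-- `X` is tangent at `1` to a closed submonoid closed under inverses as soon as it is a limit of
secants. -/
theorem exp_smul_mem_of_tendsto {S : Submonoid 𝔸} (hS : IsClosed (S : Set 𝔸))
    (hinv : ∀ a ∈ S, ∃ b ∈ S, a * b = 1) {A : ℕ → 𝔸} {ε : ℕ → ℝ} {X : 𝔸}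
    (hAS : ∀ n, A n ∈ S) (hε0 : ∀ n, 0 < ε n) (hε : Tendsto ε atTop (𝓝 0))
    (hA : Tendsto (fun n => (ε n)⁻¹ • (A n - 1)) atTop (𝓝 X)) (t : ℝ) :
    exp (t • X) ∈ S := by
  have key : ∀ t : ℝ, 0 ≤ t → exp (t • X) ∈ S := by
    intro t ht
    have hm : Tendsto (fun n => (⌊t * (ε n)⁻¹⌋₊ : ℝ) * ε n) atTop (𝓝 t) := by
      have h1 : Tendsto (fun n => (ε n)⁻¹) atTop atTop :=
        Tendsto.inv_tendsto_nhdsGT_zero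
          (tendsto_nhdsWithin_iff.2 ⟨hε, Eventually.of_forall hε0⟩)
      refine ((tendsto_nat_floor_mul_div_atTop ht).comp h1).congr fun n => ?_
      simp [div_eq_mul_inv]
    exact hS.mem_of_tendsto (tendsto_pow_exp_of_tendsto hε0 hε hm hA)
      (Eventually.of_forall fun n => pow_mem (hAS n) _)
  rcases le_total 0 t with ht | ht
  · exact key t ht
  · obtain ⟨b, hb, hab⟩ := hinv _ (key (-t) (neg_nonneg.2 ht))
    have h := exp_neg_mul_exp_of_real ((-t) • X)
    rw [neg_smul, neg_neg] at h
    rw [neg_smul] at hab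
    rwa [left_inv_eq_right_inv h hab]

theorem exp_smul_mem_of_hasDerivAt {S : Submonoid 𝔸} (hS : IsClosed (S : Set 𝔸))
    (hinv : ∀ a ∈ S, ∃ b ∈ S, a * b = 1) {c : ℝ → 𝔸} {X : 𝔸} (hc0 : c 0 = 1)
    (hcS : ∀ t, c t ∈ S) (hc : HasDerivAt c X 0) (t : ℝ) : exp (t • X) ∈ S := by
  have hε : Tendsto (fun n : ℕ => ((n : ℝ) + 1)⁻¹) atTop (𝓝[>] 0) :=
    tendsto_inv_atTop_nhdsGT_zero.comp (tendsto_natCast_atTop_atTop.atTop_add tendsto_const_nhds)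
  refine exp_smul_mem_of_tendsto hS hinv (A := fun n : ℕ => c ((n : ℝ) + 1)⁻¹)
    (fun n => hcS _) (fun n => by positivity) (tendsto_nhdsWithin_iff.1 hε).1 ?_ t
  simpa [Function.comp_def, hc0] using hc.tendsto_slope_zero_right.comp hε

/-- The Lie algebra of a closed submonoid closed under inverses. -/
def tangentSubmodule (S : Submonoid 𝔸) (hS : IsClosed (S : Set 𝔸))
    (hinv : ∀ a ∈ S, ∃ b ∈ S, a * b = 1) : Submodule ℝ 𝔸 where
  carrier := {X | ∀ t : ℝ, exp (t • X) ∈ S}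
  zero_mem' t := by simp [exp_zero]
  smul_mem' r X hX t := by simpa [smul_smul] using hX (t * r)
  add_mem' := by
    intro X Y hX hY
    -- This curve lies in `S` and has velocity `X + Y` at `0`.
    refine exp_smul_mem_of_hasDerivAt hS hinv (c := fun t => exp (t • X) * exp (t • Y)) ?_
      (fun t => mul_mem (hX t) (hY t)) ?_
    · simp [exp_zero]
    · simpa [exp_zero] using
        (hasDerivAt_exp_smul_const (𝕂 := ℝ) X 0).fun_mul (hasDerivAt_exp_smul_const (𝕂 := ℝ) Y 0)

/-- The bracket is the derivative at `0` of `exp(tX) Y exp(-tX)`, a curve of tangent vectors; the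
tangent space is closed, being finite dimensional. -/
theorem commutator_mem_tangentSubmodule [FiniteDimensional ℝ 𝔸] {S : Submonoid 𝔸}
    (hS : IsClosed (S : Set 𝔸)) (hinv : ∀ a ∈ S, ∃ b ∈ S, a * b = 1) {X Y : 𝔸}
    (hX : X ∈ tangentSubmodule S hS hinv) (hY : Y ∈ tangentSubmodule S hS hinv) :
    X * Y - Y * X ∈ tangentSubmodule S hS hinv := by
  have hconj : ∀ t : ℝ, exp (t • X) * Y * exp (t • -X) ∈ tangentSubmodule S hS hinv := by
    intro t s
    have h1 := exp_mul_exp_neg_of_real (t • X)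
    have h2 := exp_neg_mul_exp_of_real (t • X)
    rw [smul_neg]
    rw [← smul_mul_assoc, ← mul_smul_comm, exp_conj_of_real h1 h2]
    refine mul_mem (mul_mem (hX t) (hY s)) ?_
    simpa using hX (-t)
  have hd : HasDerivAt (fun t : ℝ => exp (t • X) * Y * exp (t • -X)) (X * Y - Y * X) 0 := by
    simpa [exp_zero, sub_eq_add_neg] using
      ((hasDerivAt_exp_smul_const (𝕂 := ℝ) X 0).mul_const Y).fun_mul
        (hasDerivAt_exp_smul_const (𝕂 := ℝ) (-X) 0)
  refine (Submodule.closed_of_finiteDimensional (tangentSubmodule S hS hinv)).mem_of_tendsto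
    hd.tendsto_slope_zero (Eventually.of_forall fun t => ?_)
  exact Submodule.smul_mem _ _ (Submodule.sub_mem _ (hconj _) (hconj _))

/-- Let `𝔥` consist of tangent vectors of `S`, where `𝔥` is the kernel of `π` on `𝔤`, and suppose
that `S` lies in `exp 𝔤` near `1`. Then `S` lies in `exp 𝔥` near `1`, or `S` has a nonzero tangent
vector in `π 𝔤`. -/
theorem eventually_mem_exp_or_exists_tangent [FiniteDimensional ℝ 𝔸] {S : Submonoid 𝔸}
    (hS : IsClosed (S : Set 𝔸)) (hinv : ∀ a ∈ S, ∃ b ∈ S, a * b = 1)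
    (𝔤 : Submodule ℝ 𝔸) (π : 𝔸 →ₗ[ℝ] 𝔸)
    (hπ : ∀ X ∈ 𝔤, X - π X ∈ tangentSubmodule S hS hinv)
    (hlog : ∀ U ∈ 𝓝 (0 : 𝔸), ∀ᶠ a in 𝓝 (1 : 𝔸), a ∈ S → ∃ X ∈ 𝔤, X ∈ U ∧ exp X = a) :
    (∀ᶠ a in 𝓝 (1 : 𝔸), a ∈ S → ∃ X ∈ 𝔤, π X = 0 ∧ exp X = a) ∨
      ∃ Z ∈ 𝔤.map π, Z ≠ 0 ∧ Z ∈ tangentSubmodule S hS hinv := by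
  by_cases hcase : ∀ᶠ X in 𝓝 (0 : 𝔸), X ∈ 𝔤 → exp X ∈ S → π X = 0
  · left
    filter_upwards [hlog _ hcase] with a ha haS
    obtain ⟨X, hX𝔤, hXU, rfl⟩ := ha haS
    exact ⟨X, hX𝔤, hXU hX𝔤 haS, rfl⟩
  right
  obtain ⟨X, hX0, hX⟩ := exists_seq_forall_of_frequently (not_eventually.1 hcase)
  simp only [Classical.not_imp] at hX
  choose hX𝔤 hXS hXπ using hX
  have hZpos : ∀ n, 0 < ‖π (X n)‖ := fun n => norm_pos_iff.2 (hXπ n)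
  have hπc : Continuous π := π.continuous_of_finiteDimensional
  have hZ0 : Tendsto (fun n => π (X n)) atTop (𝓝 0) := by
    simpa [Function.comp_def] using (hπc.tendsto 0).comp hX0
  -- The candidate tangent vector is a limit of the normalised components `π (X n)`, by compactness
  -- of the unit sphere.
  obtain ⟨Z, hZ, φ, hφ, hlim⟩ := (isCompact_sphere (0 : 𝔸) 1).tendsto_subseq
    (x := fun n => ‖π (X n)‖⁻¹ • π (X n)) (fun n => by
      simp [norm_smul, inv_mul_cancel₀ (hZpos n).ne'])
  refine ⟨Z, ?_, ?_, ?_⟩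
  · refine (Submodule.closed_of_finiteDimensional (𝔤.map π)).mem_of_tendsto hlim
      (Eventually.of_forall fun n => ?_)
    exact Submodule.smul_mem _ _ (Submodule.mem_map_of_mem (hX𝔤 _))
  · rintro rfl
    simp at hZ
  · have hY0 : Tendsto (fun n => X n - π (X n)) atTop (𝓝 0) := by simpa using hX0.sub hZ0
    -- Strict differentiability is essential: the error must be small relative to `π (X n)`, which
    -- may be much smaller than `X n`.
    have hstrict : (fun n => exp (X n) - exp (X n - π (X n)) - π (X n)) =o[atTop]
        fun n => π (X n) := by
      simpa [Function.comp_def] using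
        (hasStrictFDerivAt_exp_zero (𝕂 := ℝ) (𝔸 := 𝔸)).isLittleO.comp_tendsto
          (by simpa using hX0.prodMk_nhds hY0 :
            Tendsto (fun n => (X n, X n - π (X n))) atTop (𝓝 ((0 : 𝔸), (0 : 𝔸))))
    have hdiff : Tendsto (fun n => ‖π (X n)‖⁻¹ • (exp (X n) - exp (X n - π (X n)) - π (X n)))
        atTop (𝓝 0) := by
      rw [tendsto_zero_iff_norm_tendsto_zero]
      refine hstrict.norm_norm.tendsto_div_nhds_zero.congr fun n => ?_
      rw [norm_smul, norm_inv, norm_norm, div_eq_inv_mul]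
    have hdiff' : Tendsto (fun n => ‖π (X (φ n))‖⁻¹ •
        (exp (X (φ n)) - exp (X (φ n) - π (X (φ n))))) atTop (𝓝 Z) := by
      have h := (hdiff.comp hφ.tendsto_atTop).add hlim
      rw [zero_add] at h
      refine h.congr fun n => ?_
      simp only [Function.comp_apply]
      rw [← smul_add, sub_add_cancel]
    have hE : Tendsto (fun n => exp (-(X (φ n) - π (X (φ n))))) atTop (𝓝 1) := by
      have h := (continuous_exp_of_real.tendsto _).comp (hY0.comp hφ.tendsto_atTop).neg
      simpa [Function.comp_def, exp_zero] using h
    have hfin := hE.mul hdiff'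
    rw [one_mul] at hfin
    -- With `Y = X - π X` tangent to `S`, the product `exp(-Y) exp X` lies in `S`, and its secant
    -- `exp(-Y)(exp X - exp Y) / ‖π X‖` tends to `Z`.
    refine exp_smul_mem_of_tendsto hS hinv
      (A := fun n => exp (-(X (φ n) - π (X (φ n)))) * exp (X (φ n)))
      (ε := fun n => ‖π (X (φ n))‖) (fun n => mul_mem ?_ (hXS _)) (fun n => hZpos _) ?_ ?_
    · simpa using hπ _ (hX𝔤 (φ n)) (-1)
    · simpa using (hZ0.comp hφ.tendsto_atTop).norm
    · refine hfin.congr fun n => ?_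
      rw [mul_smul_comm, mul_sub, exp_neg_mul_exp_of_real]

end BanachAlgebra

/-! ### Connectedness and subgroups. -/

/-- If `H` contains a neighbourhood of `1` in `K`, then it contains the connected subsets of `K`
through `1`. -/
theorem Subgroup.subset_of_isPreconnected {G : Type*} [Group G] [TopologicalSpace G]
    [IsTopologicalGroup G] {H K : Subgroup G} (h : ∀ᶠ g in 𝓝 (1 : G), g ∈ K → g ∈ H)
    {C : Set G} (hC : IsPreconnected C) (hCK : C ⊆ K) (h1 : (1 : G) ∈ C) : C ⊆ H := by
  -- An open subgroup of `K` is also closed, so it absorbs connected sets through `1`.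
  have hopen : IsOpen ((H.subgroupOf K : Subgroup K) : Set K) := by
    refine Subgroup.isOpen_of_mem_nhds (g := 1) _ ?_
    have h2 : Tendsto ((↑) : K → G) (𝓝 1) (𝓝 1) := continuous_subtype_val.tendsto (1 : K)
    filter_upwards [h2.eventually h] with g hg
    exact hg g.2
  have hpre : IsPreconnected {g : K | (g : G) ∈ C} := by
    refine IsInducing.subtypeVal.isPreconnected_image.1 ?_
    convert hC
    ext c
    exact ⟨by rintro ⟨g, hg, rfl⟩; exact hg, fun hc => ⟨⟨c, hCK hc⟩, hc, rfl⟩⟩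
  have hsub := hpre.subset_isClopen ⟨Subgroup.isClosed_of_isOpen _ hopen, hopen⟩
    ⟨1, by simpa using h1, one_mem _⟩
  exact fun c hc => hsub (a := ⟨c, hCK hc⟩) hc

/-! ### Irreducibility of the off-diagonal part. -/

/-- A nonzero space of `2 × I` matrices which is invariant under the rotations on the left and under
the infinitesimal isometries of the form `∑ σ i (x i)²` on the right contains all matrices, provided
that `I` does not have two elements. -/
theorem eq_top_of_invariant {I : Type*} [Fintype I] [DecidableEq I] (hI : Fintype.card I ≠ 2)
    (σ : I → ℝ) (V : Submodule ℝ (Matrix (Fin 2) I ℝ))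
    (hleft : ∀ b ∈ V, (!![0, -1; 1, 0] : Matrix (Fin 2) (Fin 2) ℝ) * b ∈ V)
    (hright : ∀ i j, i ≠ j → ∀ b ∈ V,
      b * (single i j (1 : ℝ) - (σ i * σ j) • single j i (1 : ℝ)) ∈ V)
    (hV : V ≠ ⊥) : V = ⊤ := by
  obtain ⟨b, hb, hb0⟩ := V.ne_bot_iff.1 hV
  obtain ⟨r, i, hri⟩ : ∃ r i, b r i ≠ 0 := by
    by_contra! h
    exact hb0 (Matrix.ext h)
  have hmove : ∀ l m, l ≠ m → b * single i l (1 : ℝ) ∈ V → b * single i m (1 : ℝ) ∈ V := by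
    intro l m hlm h
    have h2 := hright l m hlm _ h
    rwa [Matrix.mul_assoc, Matrix.mul_sub, Matrix.mul_smul, single_mul_single_same,
      single_mul_single_of_ne (h := hlm), smul_zero, sub_zero, one_mul] at h2
  have hone : ∃ l, b * single i l (1 : ℝ) ∈ V := by
    by_cases hex : ∃ l, l ≠ i
    · obtain ⟨l, hli⟩ := hex
      obtain ⟨j, hj⟩ : ∃ j, j ∉ ({i, l} : Finset I) := by
        by_contra! h
        have h2 : ({i, l} : Finset I) = Finset.univ := Finset.eq_univ_iff_forall.2 h
        rw [← Finset.card_univ, ← h2, Finset.card_pair hli.symm] at hI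
        exact hI rfl
      simp only [Finset.mem_insert, Finset.mem_singleton, not_or] at hj
      refine ⟨l, ?_⟩
      -- With `i`, `j`, `l` distinct, the product of the generators for `(i,j)` and `(j,l)` is
      -- exactly the matrix unit `(i,l)`: it isolates column `i` of `b` and moves it to column `l`.
      have h := hright j l hj.2 _ (hright i j (Ne.symm hj.1) _ hb)
      have hzero : ∀ p q r s : I, q ≠ r → single p q (1 : ℝ) * single r s (1 : ℝ) = 0 :=
        fun p q r s hqr => single_mul_single_of_ne (h := hqr) ..
      simpa only [Matrix.mul_assoc, Matrix.sub_mul, Matrix.mul_sub, Matrix.smul_mul,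
        Matrix.mul_smul, single_mul_single_same, hzero _ j l _ hj.2, hzero _ i j _ (Ne.symm hj.1),
        hzero _ i l _ (Ne.symm hli), smul_zero, Matrix.mul_zero, sub_zero, one_mul] using h
    · push Not at hex
      refine ⟨i, ?_⟩
      have h : b * single i i (1 : ℝ) = b := by
        ext s t
        rw [hex t, mul_single_apply_same, mul_one]
      rwa [h]
  obtain ⟨l, hl⟩ := hone
  have hall : ∀ m, b * single i m (1 : ℝ) ∈ V := fun m => by
    by_cases h : l = m
    · exact h ▸ hl
    · exact hmove l m h hl
  have hpos : b 0 i ^ 2 + b 1 i ^ 2 ≠ 0 := by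
    intro h
    have h0 : b 0 i = 0 := by nlinarith [sq_nonneg (b 0 i), sq_nonneg (b 1 i)]
    have h1 : b 1 i = 0 := by nlinarith [sq_nonneg (b 0 i), sq_nonneg (b 1 i)]
    fin_cases r
    · exact hri h0
    · exact hri h1
  have hsingle : ∀ s m, single s m (1 : ℝ) ∈ V := by
    intro s m
    -- A nonzero vector of the plane and its quarter turn form an orthogonal basis; the coordinates
    -- of a standard basis vector in it have denominator the squared norm.
    have hcol : ∀ x y : ℝ, (b 0 i ^ 2 + b 1 i ^ 2)⁻¹ •
        (x • (b * single i m (1 : ℝ)) + y • ((!![0, -1; 1, 0] : Matrix (Fin 2) (Fin 2) ℝ) * (b * single i m (1 : ℝ)))) ∈ V := fun x y =>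
      V.smul_mem _ (V.add_mem (V.smul_mem _ (hall m)) (V.smul_mem _ (hleft _ (hall m))))
    have heq : single s m (1 : ℝ) = (b 0 i ^ 2 + b 1 i ^ 2)⁻¹ •
        (b s i • (b * single i m (1 : ℝ)) +
          (if s = 0 then -b 1 i else b 0 i) • ((!![0, -1; 1, 0] : Matrix (Fin 2) (Fin 2) ℝ) * (b * single i m (1 : ℝ)))) := by
      have hentry : ∀ u v, (b * single i m (1 : ℝ)) u v = if m = v then b u i else 0 := by
        intro u v
        simp [Matrix.mul_apply, single_apply, ite_and]
      have hrot0 : ∀ (M : Matrix (Fin 2) I ℝ) v,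
          ((!![0, -1; 1, 0] : Matrix (Fin 2) (Fin 2) ℝ) * M) 0 v = -M 1 v := by
        intro M v
        rw [Matrix.mul_apply, Fin.sum_univ_two]
        simp
      have hrot1 : ∀ (M : Matrix (Fin 2) I ℝ) v,
          ((!![0, -1; 1, 0] : Matrix (Fin 2) (Fin 2) ℝ) * M) 1 v = M 0 v := by
        intro M v
        rw [Matrix.mul_apply, Fin.sum_univ_two]
        simp
      ext u v
      rw [Matrix.smul_apply, Matrix.add_apply, Matrix.smul_apply, Matrix.smul_apply, hentry]
      simp only [smul_eq_mul]
      rw [eq_inv_mul_iff_mul_eq₀ hpos]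
      by_cases hv : m = v
      · fin_cases s <;> fin_cases u <;>
          simp [hrot0, hrot1, hv] <;> ring
      · fin_cases u <;> simp [hrot0, hrot1, hentry, hv]
    rw [heq]
    exact hcol _ _
  refine eq_top_iff.2 fun M _ => ?_
  rw [matrix_eq_sum_single M]
  refine V.sum_mem fun s _ => V.sum_mem fun m _ => ?_
  simpa [smul_single] using V.smul_mem (M s m) (hsingle s m)

/-! ### Matrix exponentials and isometries of a form. -/

section Exponential

open scoped Matrix.Norms.Operator

variable {n : Type*} [Fintype n] [DecidableEq n]

theorem Matrix.exp_conj_of_mul_self_eq_one {J : Matrix n n ℝ} (hJ : J * J = 1)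
    (X : Matrix n n ℝ) : exp (J * X * J) = J * exp X * J :=
  exp_conj_of_real hJ hJ X

theorem Matrix.exp_neg_mul_exp (X : Matrix n n ℝ) : exp (-X) * exp X = 1 :=
  exp_neg_mul_exp_of_real X

theorem Matrix.exp_pow (X : Matrix n n ℝ) (k : ℕ) : exp X ^ k = exp ((k : ℝ) • X) :=
  exp_pow_of_real X k

theorem transpose_exp_mul_mul_exp {J X : Matrix n n ℝ} (hJ : J * J = 1)
    (hX : Xᵀ * J + J * X = 0) : (exp X)ᵀ * J * exp X = J := by
  have h : Xᵀ = J * (-X) * J := by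
    calc Xᵀ = Xᵀ * J * J := by rw [Matrix.mul_assoc, hJ, Matrix.mul_one]
      _ = _ := by rw [eq_neg_of_add_eq_zero_left hX, Matrix.mul_neg]
  rw [← Matrix.exp_transpose, h, Matrix.exp_conj_of_mul_self_eq_one hJ, Matrix.mul_assoc _ J J, hJ,
    Matrix.mul_one, Matrix.mul_assoc, Matrix.exp_neg_mul_exp, Matrix.mul_one]

/-- Preserving the form forces the determinant to be `±1`, and `exp X` is the square of `exp (X /
2)`. -/
theorem det_exp_eq_one {J X : Matrix n n ℝ} (hJ : J * J = 1) (hX : Xᵀ * J + J * X = 0) :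
    (exp X).det = 1 := by
  have h1 : (exp X).det * (exp X).det = 1 := by
    have h := congrArg det (transpose_exp_mul_mul_exp hJ hX)
    have hJ' := congrArg det hJ
    rw [det_mul, det_one] at hJ'
    rw [det_mul, det_mul, det_transpose] at h
    linear_combination J.det * h + (1 - (exp X).det * (exp X).det) * hJ'
  have h2 : exp X = exp ((2⁻¹ : ℝ) • X) ^ 2 := by
    rw [Matrix.exp_pow, smul_smul]
    norm_num
  have h3 : 0 ≤ (exp X).det := by
    rw [h2, det_pow]
    positivity
  nlinarith

theorem exp_fromBlocks_zero_zero {m : Type*} [Fintype m] [DecidableEq m] (A : Matrix m m ℝ)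
    (B : Matrix n n ℝ) : exp (fromBlocks A 0 0 B) = fromBlocks (exp A) 0 0 (exp B) := by
  let f : Matrix m m ℝ × Matrix n n ℝ →+* Matrix (m ⊕ n) (m ⊕ n) ℝ :=
    { toFun := fun X => fromBlocks X.1 0 0 X.2
      map_one' := fromBlocks_one
      map_zero' := fromBlocks_zero
      map_mul' := fun X Y => by simp [fromBlocks_multiply]
      map_add' := fun X Y => by simp [fromBlocks_add] }
  have hf : Continuous f :=
    continuous_fst.matrix_fromBlocks continuous_const continuous_const continuous_snd
  let _ : NormedAlgebra ℚ (Matrix m m ℝ) := NormedAlgebra.restrictScalars ℚ ℝ _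
  let _ : NormedAlgebra ℚ (Matrix n n ℝ) := NormedAlgebra.restrictScalars ℚ ℝ _
  let _ : NormedAlgebra ℚ (Matrix (m ⊕ n) (m ⊕ n) ℝ) := NormedAlgebra.restrictScalars ℚ ℝ _
  have h : f (exp (A, B)) = exp (fromBlocks A 0 0 B) := map_exp f hf (A, B)
  have h2 : exp (A, B) = (exp A, exp B) :=
    Prod.ext (Prod.fst_exp (A, B)) (Prod.snd_exp (A, B))
  exact h.symm.trans (congrArg f h2)

/-- Near the identity, the isometries of a form are exponentials of infinitesimal isometries. -/
theorem eventually_exists_exp_eq {J : Matrix n n ℝ} (hJ : J * J = 1) {U : Set (Matrix n n ℝ)}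
    (hU : U ∈ 𝓝 0) : ∀ᶠ A in 𝓝 (1 : Matrix n n ℝ), Aᵀ * J * A = J →
      ∃ X, Xᵀ * J + J * X = 0 ∧ X ∈ U ∧ exp X = A := by
  obtain ⟨L, hL1, hL, hLe, heL⟩ : ∃ L : Matrix n n ℝ → Matrix n n ℝ, L 1 = 0 ∧
      ContinuousAt L 1 ∧ (∀ᶠ A in 𝓝 (1 : Matrix n n ℝ), exp (L A) = A) ∧
        ∀ᶠ X in 𝓝 (0 : Matrix n n ℝ), L (exp X) = X := by
    obtain ⟨L, hL1, hL, h⟩ := exists_local_log (𝔸 := Matrix n n ℝ)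
    exact ⟨L, hL1, hL.continuousAt, h⟩
  have hL0 : Tendsto L (𝓝 1) (𝓝 0) := hL1 ▸ hL.tendsto
  have hneg : Tendsto (fun A => -L A) (𝓝 1) (𝓝 0) := by simpa using hL0.neg
  have hadj : Tendsto (fun A => J * (L A)ᵀ * J) (𝓝 1) (𝓝 0) := by
    have hc : Continuous fun X : Matrix n n ℝ => J * Xᵀ * J := by fun_prop
    simpa [Function.comp_def] using (hc.tendsto 0).comp hL0
  filter_upwards [hL0.eventually hU, hLe, hneg.eventually heL, hadj.eventually heL]
    with A hAU hA hA1 hA2 hAJ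
  refine ⟨L A, ?_, hAU, hA⟩
  -- Both `J (log A)ᵀ J` and `-log A` are small logarithms of `A⁻¹`, so local injectivity of `exp`
  -- identifies them.
  have h1 : exp (J * (L A)ᵀ * J) = exp (-L A) := by
    rw [Matrix.exp_conj_of_mul_self_eq_one hJ, Matrix.exp_transpose, hA]
    refine left_inv_eq_right_inv (a := A) ?_ ?_
    · rw [Matrix.mul_assoc, Matrix.mul_assoc, ← Matrix.mul_assoc Aᵀ, hAJ, hJ]
    · nth_rewrite 1 [← hA]
      exact exp_mul_exp_neg_of_real _
  have h2 : J * (L A)ᵀ * J = -L A := by rw [← hA2, ← hA1, h1]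
  calc (L A)ᵀ * J + J * L A = J * (J * (L A)ᵀ * J) + J * L A := by
        rw [← Matrix.mul_assoc, ← Matrix.mul_assoc, hJ, Matrix.one_mul]
    _ = 0 := by rw [h2, Matrix.mul_neg, neg_add_cancel]

end Exponential

theorem indefiniteDiagonal_mul_self (p q : ℕ) :
    LieAlgebra.Orthogonal.indefiniteDiagonal (Fin p) (Fin q) ℝ *
      LieAlgebra.Orthogonal.indefiniteDiagonal (Fin p) (Fin q) ℝ = 1 := by
  rw [LieAlgebra.Orthogonal.indefiniteDiagonal, diagonal_mul_diagonal, ← diagonal_one]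
  congr 1
  ext (i | i) <;> simp

open scoped Matrix.Norms.Operator in
-- The path `t ↦ exp (t • X)` joins `1` to `exp X` inside `SO(p,q)`.
theorem exists_mem_indefSOPlus_eq_exp {p q : ℕ} {X : Matrix (Fin p ⊕ Fin q) (Fin p ⊕ Fin q) ℝ}
    (hX : Xᵀ * LieAlgebra.Orthogonal.indefiniteDiagonal (Fin p) (Fin q) ℝ +
      LieAlgebra.Orthogonal.indefiniteDiagonal (Fin p) (Fin q) ℝ * X = 0) :
    ∃ B ∈ indefSOPlus p q, (B : Matrix (Fin p ⊕ Fin q) (Fin p ⊕ Fin q) ℝ) = exp X := by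
  have hJ := indefiniteDiagonal_mul_self p q
  have hX' : ∀ t : ℝ, (t • X)ᵀ * LieAlgebra.Orthogonal.indefiniteDiagonal (Fin p) (Fin q) ℝ +
      LieAlgebra.Orthogonal.indefiniteDiagonal (Fin p) (Fin q) ℝ * (t • X) = 0 := fun t => by
    rw [transpose_smul, Matrix.smul_mul, Matrix.mul_smul, ← smul_add, hX, smul_zero]
  let c : ℝ → indefSO p q := fun t =>
    ⟨⟨exp (t • X), det_exp_eq_one hJ (hX' t)⟩, transpose_exp_mul_mul_exp hJ (hX' t)⟩
  have hc : Continuous c := by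
    refine Continuous.subtype_mk (Continuous.subtype_mk ?_ _) _
    exact continuous_exp_of_real.comp (continuous_id.smul continuous_const)
  have h0 : c 0 = 1 := by
    refine Subtype.ext (Subtype.ext ?_)
    change exp ((0 : ℝ) • X) = 1
    rw [zero_smul, exp_zero]
  have hmem : c 1 ∈ connectedComponent (1 : indefSO p q) :=
    (isPreconnected_range hc).subset_connectedComponent ⟨0, h0⟩ ⟨1, rfl⟩
  refine ⟨(c 1 : SpecialLinearGroup (Fin p ⊕ Fin q) ℝ), ⟨c 1, hmem, rfl⟩, ?_⟩
  change exp ((1 : ℝ) • X) = exp X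
  rw [one_smul]

theorem exp_mem_specialOrthogonalGroup {n : Type*} [Fintype n] [DecidableEq n] {X : Matrix n n ℝ}
    (hX : Xᵀ + X = 0) : exp X ∈ specialOrthogonalGroup n ℝ := by
  have hX' : Xᵀ * 1 + 1 * X = 0 := by rwa [Matrix.mul_one, Matrix.one_mul]
  refine mem_specialOrthogonalGroup_iff.2 ⟨(mem_orthogonalGroup_iff' _ _).2 ?_,
    det_exp_eq_one (Matrix.mul_one 1) hX'⟩
  simpa using transpose_exp_mul_mul_exp (Matrix.mul_one 1) hX'

/-! ### Change of basis. -/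

/-- The matrices of the elements of `S` in the basis formed by the columns of `P`, where `R` is the
inverse of `P`. -/
def conjSubmonoid {m n : Type*} [Fintype m] [DecidableEq m] [Fintype n] [DecidableEq n]
    (S : Subgroup (SpecialLinearGroup m ℝ)) {P : Matrix m n ℝ} {R : Matrix n m ℝ}
    (hPR : P * R = 1) (hRP : R * P = 1) : Submonoid (Matrix n n ℝ) where
  carrier := {X | ∃ g ∈ S, (g : Matrix m m ℝ) = P * X * R}
  one_mem' := ⟨1, one_mem S, by rw [Matrix.mul_one, hPR]; rfl⟩
  mul_mem' := by
    rintro X Y ⟨g, hg, hgX⟩ ⟨h, hh, hhY⟩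
    refine ⟨g * h, mul_mem hg hh, ?_⟩
    calc g.1 * h.1 = P * X * (R * P) * Y * R := by
            rw [hgX, hhY]
            simp only [Matrix.mul_assoc]
      _ = _ := by rw [hRP, Matrix.mul_one, Matrix.mul_assoc P]

section conjSubmonoid

variable {m n : Type*} [Fintype m] [DecidableEq m] [Fintype n] [DecidableEq n]
  {S : Subgroup (SpecialLinearGroup m ℝ)} {P : Matrix m n ℝ} {R : Matrix n m ℝ}

theorem mul_mul_mem_conjSubmonoid_iff (hPR : P * R = 1) (hRP : R * P = 1)
    (g : SpecialLinearGroup m ℝ) : R * g.1 * P ∈ conjSubmonoid S hPR hRP ↔ g ∈ S := by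
  have h : P * (R * g.1 * P) * R = g.1 := by
    calc _ = (P * R) * g.1 * (P * R) := by simp only [Matrix.mul_assoc]
      _ = _ := by rw [hPR, Matrix.mul_one, Matrix.one_mul]
  constructor
  · rintro ⟨g', hg', hgg'⟩
    have hgg : g' = g := Subtype.ext (hgg'.trans h)
    rwa [hgg] at hg'
  · exact fun hg => ⟨g, hg, h.symm⟩

theorem conjSubmonoid_mono {S' : Subgroup (SpecialLinearGroup m ℝ)} (h : S ≤ S')
    (hPR : P * R = 1) (hRP : R * P = 1) : conjSubmonoid S hPR hRP ≤ conjSubmonoid S' hPR hRP :=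
  fun _ ⟨g, hg, hgX⟩ => ⟨g, h hg, hgX⟩

theorem isClosed_conjSubmonoid (hS : IsClosed (S : Set (SpecialLinearGroup m ℝ)))
    (hPR : P * R = 1) (hRP : R * P = 1) :
    IsClosed (conjSubmonoid S hPR hRP : Set (Matrix n n ℝ)) := by
  have h := SpecialLinearGroup.isClosedEmbedding_val.isClosedMap _ hS
  have hc : Continuous fun X : Matrix n n ℝ => P * X * R := by fun_prop
  exact h.preimage hc

theorem exists_mul_eq_one_of_mem_conjSubmonoid (hPR : P * R = 1) (hRP : R * P = 1) :
    ∀ X ∈ conjSubmonoid S hPR hRP, ∃ Y ∈ conjSubmonoid S hPR hRP, X * Y = 1 := by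
  rintro X ⟨g, hg, hgX⟩
  refine ⟨R * g⁻¹.1 * P, (mul_mul_mem_conjSubmonoid_iff hPR hRP _).2 (inv_mem hg), ?_⟩
  have hX : X = R * g.1 * P := by
    rw [hgX]
    calc X = (R * P) * X * (R * P) := by rw [hRP, Matrix.mul_one, Matrix.one_mul]
      _ = _ := by simp only [Matrix.mul_assoc]
  have hg1 : g.1 * g⁻¹.1 = 1 := congrArg Subtype.val (mul_inv_cancel g)
  calc X * (R * g⁻¹.1 * P) = R * (g.1 * (P * R) * g⁻¹.1) * P := by
        rw [hX]
        simp only [Matrix.mul_assoc]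
    _ = 1 := by rw [hPR, Matrix.mul_one, hg1, Matrix.mul_one, hRP]

omit [Fintype n] in
theorem tendsto_mul_val_mul (hRP : R * P = 1) :
    Tendsto (fun g : SpecialLinearGroup m ℝ => R * g.1 * P) (𝓝 1) (𝓝 1) := by
  have hc : Continuous fun g : SpecialLinearGroup m ℝ => R * g.1 * P :=
    (continuous_const.matrix_mul continuous_subtype_val).matrix_mul continuous_const
  have h := hc.tendsto 1
  rwa [show R * (1 : SpecialLinearGroup m ℝ).1 * P = 1 from
    (congrArg (· * P) (Matrix.mul_one R)).trans hRP] at h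

end conjSubmonoid

theorem skew_diagonal {n : Type*} [Fintype n] [DecidableEq n] (σ : n → ℝ)
    (hσ : ∀ i, σ i * σ i = 1) (i j : n) :
    (single i j (1 : ℝ) - (σ i * σ j) • single j i (1 : ℝ))ᵀ * diagonal σ +
      diagonal σ * (single i j (1 : ℝ) - (σ i * σ j) • single j i (1 : ℝ)) = 0 := by
  by_cases hij : i = j
  · subst hij
    simp [hσ]
  have hj : σ i * σ j * σ j = σ i := by rw [mul_assoc, hσ, mul_one]
  ext u v
  simp only [Matrix.add_apply, mul_diagonal, diagonal_mul, transpose_apply, Matrix.sub_apply,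
    Matrix.smul_apply, single_apply, Matrix.zero_apply, smul_eq_mul]
  by_cases h1 : i = u ∧ j = v
  · obtain ⟨rfl, rfl⟩ := h1
    rw [if_neg fun h => hij h.1, if_pos ⟨rfl, rfl⟩, if_pos ⟨rfl, rfl⟩, if_neg fun h => hij h.2]
    linear_combination -hj
  by_cases h2 : j = u ∧ i = v
  · obtain ⟨rfl, rfl⟩ := h2
    rw [if_pos ⟨rfl, rfl⟩, if_neg fun h => hij h.2, if_neg fun h => hij h.1, if_pos ⟨rfl, rfl⟩]
    linear_combination -hj
  rw [if_neg fun h => h2 h.symm, if_neg fun h => h1 h.symm, if_neg h1, if_neg h2]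
  ring

/-! ### The block decomposition of the Lie algebra. -/

section Splitting

open LieAlgebra.Orthogonal

variable {k : ℕ}

/-- The form `diag(1, 1, 1, -1, …, -1)` on `ℝ^{2,0} ⊕ ℝ^{1,k}`. -/
def splitForm (k : ℕ) : Matrix (Fin 2 ⊕ (Fin 1 ⊕ Fin k)) (Fin 2 ⊕ (Fin 1 ⊕ Fin k)) ℝ :=
  fromBlocks 1 0 0 (indefiniteDiagonal (Fin 1) (Fin k) ℝ)

theorem splitForm_mul_self (k : ℕ) : splitForm k * splitForm k = 1 := by
  rw [splitForm, fromBlocks_multiply]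
  simp [indefiniteDiagonal_mul_self]

/-- The infinitesimal isometries of `splitForm`. -/
def splitSO (k : ℕ) : Submodule ℝ (Matrix (Fin 2 ⊕ (Fin 1 ⊕ Fin k)) (Fin 2 ⊕ (Fin 1 ⊕ Fin k)) ℝ) where
  carrier := {X | Xᵀ * splitForm k + splitForm k * X = 0}
  zero_mem' := by simp
  add_mem' := by
    intro X Y hX hY
    change (X + Y)ᵀ * _ + _ * (X + Y) = 0
    rw [transpose_add, Matrix.add_mul, Matrix.mul_add, add_add_add_comm, hX, hY, add_zero]
  smul_mem' := by
    intro c X hX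
    change (c • X)ᵀ * _ + _ * (c • X) = 0
    rw [transpose_smul, Matrix.smul_mul, Matrix.mul_smul, ← smul_add, hX, smul_zero]

/-- The block off-diagonal infinitesimal isometry with upper right block `b`. -/
def offDiagonal (k : ℕ) : Matrix (Fin 2) (Fin 1 ⊕ Fin k) ℝ →ₗ[ℝ]
    Matrix (Fin 2 ⊕ (Fin 1 ⊕ Fin k)) (Fin 2 ⊕ (Fin 1 ⊕ Fin k)) ℝ where
  toFun b := fromBlocks 0 b (-(indefiniteDiagonal (Fin 1) (Fin k) ℝ * bᵀ)) 0
  map_add' b c := by simp [fromBlocks_add, Matrix.mul_add, add_comm]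
  map_smul' r b := by simp [fromBlocks_smul]

/-- The projection onto block off-diagonal matrices. -/
def offDiagonalPart (k : ℕ) : Matrix (Fin 2 ⊕ (Fin 1 ⊕ Fin k)) (Fin 2 ⊕ (Fin 1 ⊕ Fin k)) ℝ →ₗ[ℝ]
    Matrix (Fin 2 ⊕ (Fin 1 ⊕ Fin k)) (Fin 2 ⊕ (Fin 1 ⊕ Fin k)) ℝ where
  toFun X := fromBlocks 0 X.toBlocks₁₂ X.toBlocks₂₁ 0
  map_add' X Y := by
    rw [fromBlocks_add, add_zero, add_zero]
    rfl
  map_smul' r X := by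
    rw [RingHom.id_apply, fromBlocks_smul, smul_zero, smul_zero]
    rfl

/-- The decomposition `𝔥 ⊕ 𝔪`: the mixed block equation determines the lower left block from the
upper right one. -/
theorem exists_of_mem_splitSO {X : Matrix (Fin 2 ⊕ (Fin 1 ⊕ Fin k)) (Fin 2 ⊕ (Fin 1 ⊕ Fin k)) ℝ}
    (hX : X ∈ splitSO k) : ∃ A b D, Aᵀ + A = 0 ∧
      Dᵀ * indefiniteDiagonal (Fin 1) (Fin k) ℝ + indefiniteDiagonal (Fin 1) (Fin k) ℝ * D = 0 ∧
      X = fromBlocks A 0 0 D + offDiagonal k b ∧ offDiagonalPart k X = offDiagonal k b := by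
  have h : Xᵀ * splitForm k + splitForm k * X = 0 := hX
  rw [← fromBlocks_toBlocks X, splitForm, fromBlocks_transpose, fromBlocks_multiply,
    fromBlocks_multiply, fromBlocks_add, ← fromBlocks_zero, fromBlocks_inj] at h
  simp only [Matrix.mul_one, Matrix.mul_zero, Matrix.one_mul, Matrix.zero_mul, add_zero,
    zero_add] at h
  obtain ⟨h11, -, h21, h22⟩ := h
  have hc : X.toBlocks₂₁ = -(indefiniteDiagonal (Fin 1) (Fin k) ℝ * X.toBlocks₁₂ᵀ) := by
    rw [eq_neg_of_add_eq_zero_left h21, Matrix.mul_neg, neg_neg, ← Matrix.mul_assoc,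
      indefiniteDiagonal_mul_self, Matrix.one_mul]
  refine ⟨X.toBlocks₁₁, X.toBlocks₁₂, X.toBlocks₂₂, h11, h22, ?_, ?_⟩
  · conv_lhs => rw [← fromBlocks_toBlocks X]
    simp [offDiagonal, fromBlocks_add, hc]
  · simp [offDiagonal, offDiagonalPart, hc]

/-- The adjoint action of `𝔥` on `𝔪`, read on upper right blocks. -/
theorem commutator_offDiagonal {A : Matrix (Fin 2) (Fin 2) ℝ}
    {D : Matrix (Fin 1 ⊕ Fin k) (Fin 1 ⊕ Fin k) ℝ} (hA : Aᵀ + A = 0)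
    (hD : Dᵀ * indefiniteDiagonal (Fin 1) (Fin k) ℝ + indefiniteDiagonal (Fin 1) (Fin k) ℝ * D = 0)
    (b : Matrix (Fin 2) (Fin 1 ⊕ Fin k) ℝ) :
    fromBlocks A 0 0 D * offDiagonal k b - offDiagonal k b * fromBlocks A 0 0 D =
      offDiagonal k (A * b - b * D) := by
  have hJ := indefiniteDiagonal_mul_self 1 k
  have hD' : indefiniteDiagonal (Fin 1) (Fin k) ℝ * Dᵀ =
      -(D * indefiniteDiagonal (Fin 1) (Fin k) ℝ) := by
    calc _ = indefiniteDiagonal (Fin 1) (Fin k) ℝ *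
          (Dᵀ * indefiniteDiagonal (Fin 1) (Fin k) ℝ) *
          indefiniteDiagonal (Fin 1) (Fin k) ℝ := by
            rw [Matrix.mul_assoc, Matrix.mul_assoc, hJ, Matrix.mul_one]
      _ = _ := by
        rw [eq_neg_of_add_eq_zero_left hD, Matrix.mul_neg, ← Matrix.mul_assoc, hJ, Matrix.one_mul,
          Matrix.neg_mul]
  have hA' : Aᵀ = -A := eq_neg_of_add_eq_zero_left hA
  change fromBlocks A 0 0 D * fromBlocks _ _ _ _ - fromBlocks _ _ _ _ * fromBlocks A 0 0 D =
    fromBlocks _ _ _ _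
  rw [fromBlocks_multiply, fromBlocks_multiply, sub_eq_add_neg (fromBlocks _ _ _ _),
    fromBlocks_neg, fromBlocks_add, fromBlocks_inj]
  refine ⟨by simp, by simp [sub_eq_add_neg], ?_, by simp⟩
  rw [transpose_sub, transpose_mul, transpose_mul, hA', Matrix.mul_sub,
    ← Matrix.mul_assoc _ Dᵀ, hD']
  simp only [Matrix.mul_neg, Matrix.neg_mul, Matrix.mul_assoc, Matrix.mul_zero,
    zero_add, add_zero]
  abel

variable {P : Matrix (Fin 3 ⊕ Fin k) (Fin 2 ⊕ (Fin 1 ⊕ Fin k)) ℝ}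
  {R : Matrix (Fin 2 ⊕ (Fin 1 ⊕ Fin k)) (Fin 3 ⊕ Fin k) ℝ}

theorem IsPlaneSplitting.exists_inverse (hP : IsPlaneSplitting k P) :
    ∃ R : Matrix (Fin 2 ⊕ (Fin 1 ⊕ Fin k)) (Fin 3 ⊕ Fin k) ℝ, P * R = 1 ∧ R * P = 1 := by
  have h : splitForm k * Pᵀ * indefiniteDiagonal (Fin 3) (Fin k) ℝ * P = 1 := by
    rw [Matrix.mul_assoc, Matrix.mul_assoc, ← Matrix.mul_assoc Pᵀ, hP]
    exact splitForm_mul_self k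
  refine ⟨_, (mul_eq_one_comm_of_card_eq _ _ _ ?_).1 h, h⟩
  simp only [Fintype.card_sum, Fintype.card_fin]
  omega

theorem IsPlaneSplitting.transpose_mul_splitForm_mul (hP : IsPlaneSplitting k P)
    (hPR : P * R = 1) {g : SpecialLinearGroup (Fin 3 ⊕ Fin k) ℝ} (hg : g ∈ indefSO 3 k) :
    (R * g.1 * P)ᵀ * splitForm k * (R * g.1 * P) = splitForm k := by
  have h1 : P * (R * g.1 * P) = g.1 * P := by
    rw [← Matrix.mul_assoc, ← Matrix.mul_assoc, hPR, Matrix.one_mul]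
  have hg' : g.1ᵀ * indefiniteDiagonal (Fin 3) (Fin k) ℝ * g.1 =
    indefiniteDiagonal (Fin 3) (Fin k) ℝ := hg
  have hP' : Pᵀ * indefiniteDiagonal (Fin 3) (Fin k) ℝ * P = splitForm k := hP
  calc _ = (R * g.1 * P)ᵀ * (Pᵀ * indefiniteDiagonal (Fin 3) (Fin k) ℝ * P) * (R * g.1 * P) := by
        rw [hP']
    _ = (P * (R * g.1 * P))ᵀ * indefiniteDiagonal (Fin 3) (Fin k) ℝ * (P * (R * g.1 * P)) := by
        rw [transpose_mul P]
        simp only [Matrix.mul_assoc]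
    _ = Pᵀ * (g.1ᵀ * indefiniteDiagonal (Fin 3) (Fin k) ℝ * g.1) * P := by
        rw [h1, transpose_mul]
        simp only [Matrix.mul_assoc]
    _ = splitForm k := by rw [hg', hP']

theorem indefSOPlus_le_indefSO (p q : ℕ) : indefSOPlus p q ≤ indefSO p q := by
  rintro _ ⟨g, -, rfl⟩
  exact g.2

open scoped Matrix.Norms.Operator

theorem exp_fromBlocks_mem_conjSubmonoid (hPR : P * R = 1) (hRP : R * P = 1)
    {A : Matrix (Fin 2) (Fin 2) ℝ} {D : Matrix (Fin 1 ⊕ Fin k) (Fin 1 ⊕ Fin k) ℝ}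
    (hA : Aᵀ + A = 0)
    (hD : Dᵀ * indefiniteDiagonal (Fin 1) (Fin k) ℝ +
      indefiniteDiagonal (Fin 1) (Fin k) ℝ * D = 0) :
    exp (fromBlocks A 0 0 D) ∈ conjSubmonoid (planeSubgroup k P) hPR hRP := by
  obtain ⟨B, hB, hBD⟩ := exists_mem_indefSOPlus_eq_exp hD
  have hA' := exp_mem_specialOrthogonalGroup hA
  rw [exp_fromBlocks_zero_zero]
  have hdet : (P * fromBlocks (exp A) 0 0 (exp D) * R).det = 1 := by
    rw [det_conj_of_mul_eq_one hPR hRP, det_fromBlocks_zero₂₁,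
      (mem_specialOrthogonalGroup_iff.1 hA').2, ← hBD, B.2, one_mul]
  refine ⟨⟨_, hdet⟩, ⟨_, hA', B, hB, ?_⟩, rfl⟩
  change P * fromBlocks (exp A) 0 0 (exp D) * R * P = _
  rw [Matrix.mul_assoc, hRP, Matrix.mul_one, hBD]

/-- The Lie algebra of a closed subgroup `S`, in the basis formed by the columns of `P`. -/
noncomputable def splitLie {S : Subgroup (SpecialLinearGroup (Fin 3 ⊕ Fin k) ℝ)}
    (hS : IsClosed (S : Set (SpecialLinearGroup (Fin 3 ⊕ Fin k) ℝ)))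
    (hPR : P * R = 1) (hRP : R * P = 1) :
    Submodule ℝ (Matrix (Fin 2 ⊕ (Fin 1 ⊕ Fin k)) (Fin 2 ⊕ (Fin 1 ⊕ Fin k)) ℝ) :=
  tangentSubmodule (conjSubmonoid S hPR hRP) (isClosed_conjSubmonoid hS hPR hRP)
    (exists_mul_eq_one_of_mem_conjSubmonoid hPR hRP)

variable {S : Subgroup (SpecialLinearGroup (Fin 3 ⊕ Fin k) ℝ)}
  (hS : IsClosed (S : Set (SpecialLinearGroup (Fin 3 ⊕ Fin k) ℝ)))
  (hPR : P * R = 1) (hRP : R * P = 1)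

theorem fromBlocks_mem_splitLie (hHS : planeSubgroup k P ≤ S)
    {A : Matrix (Fin 2) (Fin 2) ℝ} {D : Matrix (Fin 1 ⊕ Fin k) (Fin 1 ⊕ Fin k) ℝ}
    (hA : Aᵀ + A = 0)
    (hD : Dᵀ * indefiniteDiagonal (Fin 1) (Fin k) ℝ +
      indefiniteDiagonal (Fin 1) (Fin k) ℝ * D = 0) :
    fromBlocks A 0 0 D ∈ splitLie hS hPR hRP := by
  intro t
  refine conjSubmonoid_mono hHS hPR hRP ?_
  have h : t • fromBlocks A 0 0 D = fromBlocks (t • A) 0 0 (t • D) := by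
    rw [fromBlocks_smul, smul_zero, smul_zero]
  have hmem := exp_fromBlocks_mem_conjSubmonoid hPR hRP (A := t • A) (D := t • D)
    (by rw [transpose_smul, ← smul_add, hA, smul_zero])
    (by rw [transpose_smul, Matrix.smul_mul, Matrix.mul_smul, ← smul_add, hD, smul_zero])
  rwa [← h] at hmem

/-- The Lie algebra of a closed subgroup containing `planeSubgroup k P` contains all infinitesimal
isometries as soon as it contains a nonzero off-diagonal one. -/
theorem splitSO_le_splitLie (hk : k ≠ 1) (hHS : planeSubgroup k P ≤ S)
    {b₀ : Matrix (Fin 2) (Fin 1 ⊕ Fin k) ℝ} (hb₀ : b₀ ≠ 0)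
    (hmem : offDiagonal k b₀ ∈ splitLie hS hPR hRP) : splitSO k ≤ splitLie hS hPR hRP := by
  have hbracket : ∀ {A : Matrix (Fin 2) (Fin 2) ℝ} {D : Matrix (Fin 1 ⊕ Fin k) (Fin 1 ⊕ Fin k) ℝ},
      Aᵀ + A = 0 → Dᵀ * indefiniteDiagonal (Fin 1) (Fin k) ℝ +
        indefiniteDiagonal (Fin 1) (Fin k) ℝ * D = 0 →
      ∀ b ∈ (splitLie hS hPR hRP).comap (offDiagonal k),
        A * b - b * D ∈ (splitLie hS hPR hRP).comap (offDiagonal k) := by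
    intro A D hA hD b hb
    rw [Submodule.mem_comap, ← commutator_offDiagonal hA hD]
    exact commutator_mem_tangentSubmodule _ _ (fromBlocks_mem_splitLie hS hPR hRP hHS hA hD) hb
  -- The only use of `k ≠ 1`.
  have hcard : Fintype.card (Fin 1 ⊕ Fin k) ≠ 2 := by
    rw [Fintype.card_sum, Fintype.card_fin, Fintype.card_fin]
    omega
  have htop : (splitLie hS hPR hRP).comap (offDiagonal k) = ⊤ := by
    refine eq_top_of_invariant hcard (Sum.elim (fun _ => 1) fun _ => -1) _ ?_ ?_ ?_
    · intro b hb
      have hrot : (!![0, -1; 1, 0] : Matrix (Fin 2) (Fin 2) ℝ)ᵀ + !![0, -1; 1, 0] = 0 := by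
        ext i j
        fin_cases i <;> fin_cases j <;> simp
      simpa using hbracket hrot (D := 0) (by simp) b hb
    · intro i j hij b hb
      have h := hbracket (A := 0) (D := single i j (1 : ℝ) -
        (Sum.elim (fun _ => 1) (fun _ => -1) i * Sum.elim (fun _ => 1) (fun _ => -1) j : ℝ) •
          single j i (1 : ℝ)) (by simp)
        (skew_diagonal _ (by rintro (i | i) <;> simp) i j) b hb
      simpa using neg_mem h
    · exact fun h => hb₀ ((Submodule.mem_bot ℝ).1 (h ▸ (Submodule.mem_comap.2 hmem)))
  intro X hX
  obtain ⟨A, b, D, hA, hD, rfl, -⟩ := exists_of_mem_splitSO hX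
  refine add_mem (fromBlocks_mem_splitLie hS hPR hRP hHS hA hD) ?_
  exact Submodule.mem_comap.1 (htop ▸ Submodule.mem_top)

end Splitting

/-! ### The main theorem. -/

open scoped Matrix.Norms.Operator in
theorem mainTheorem10 (k : ℕ) (hk : k ≠ 1)
    (P : Matrix (Fin 3 ⊕ Fin k) (Fin 2 ⊕ (Fin 1 ⊕ Fin k)) ℝ) (hP : IsPlaneSplitting k P)
    (S : Subgroup (Matrix.SpecialLinearGroup (Fin 3 ⊕ Fin k) ℝ))
    (hSG : S ≤ indefSOPlus 3 k)
    (hclosed : IsClosed (S : Set (Matrix.SpecialLinearGroup (Fin 3 ⊕ Fin k) ℝ)))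
    (hconn : IsConnected (S : Set (Matrix.SpecialLinearGroup (Fin 3 ⊕ Fin k) ℝ)))
    (hHS : planeSubgroup k P ≤ S) :
    S = indefSOPlus 3 k ∨ S = planeSubgroup k P := by
  obtain ⟨R, hPR, hRP⟩ := hP.exists_inverse
  have hlog : ∀ U ∈ 𝓝 (0 : Matrix (Fin 2 ⊕ (Fin 1 ⊕ Fin k)) (Fin 2 ⊕ (Fin 1 ⊕ Fin k)) ℝ),
      ∀ᶠ a in 𝓝 1, a ∈ conjSubmonoid S hPR hRP → ∃ X ∈ splitSO k, X ∈ U ∧ exp X = a := by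
    intro U hU
    filter_upwards [eventually_exists_exp_eq (splitForm_mul_self k) hU] with a ha haS
    refine ha ?_
    obtain ⟨g, hg, hga⟩ := haS
    have h := hP.transpose_mul_splitForm_mul hPR (indefSOPlus_le_indefSO 3 k (hSG hg))
    have hag : R * g.1 * P = a := by
      rw [hga]
      calc _ = (R * P) * a * (R * P) := by simp only [Matrix.mul_assoc]
        _ = _ := by rw [hRP, Matrix.mul_one, Matrix.one_mul]
    rwa [hag] at h
  have hπ : ∀ X ∈ splitSO k, X - offDiagonalPart k X ∈ splitLie hclosed hPR hRP := by
    intro X hX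
    obtain ⟨A, b, D, hA, hD, hXe, hXp⟩ := exists_of_mem_splitSO hX
    rw [hXp, hXe, add_sub_cancel_right]
    exact fromBlocks_mem_splitLie hclosed hPR hRP hHS hA hD
  rcases eventually_mem_exp_or_exists_tangent _ _ (splitSO k) (offDiagonalPart k) hπ hlog with
    h | ⟨Z, ⟨X, hX, rfl⟩, hZ0, hZ⟩
  · right
    refine le_antisymm ?_ hHS
    refine Subgroup.subset_of_isPreconnected (K := S) ?_ hconn.isPreconnected subset_rfl
      (one_mem S)
    filter_upwards [(tendsto_mul_val_mul hRP).eventually h] with g hg hgS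
    obtain ⟨X, hX, hX0, hXg⟩ := hg ((mul_mul_mem_conjSubmonoid_iff hPR hRP g).2 hgS)
    obtain ⟨A, b, D, hA, hD, hXe, hXp⟩ := exists_of_mem_splitSO hX
    -- The off-diagonal part vanishes, so `X` lies in `𝔥`.
    rw [← hXp, hX0, add_zero] at hXe
    rw [← mul_mul_mem_conjSubmonoid_iff hPR hRP, ← hXg, hXe]
    exact exp_fromBlocks_mem_conjSubmonoid hPR hRP hA hD
  · left
    refine le_antisymm hSG ?_
    obtain ⟨A, b, D, hA, hD, hXe, hXp⟩ := exists_of_mem_splitSO hX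
    rw [hXp] at hZ0 hZ
    have hall := splitSO_le_splitLie hclosed hPR hRP hk hHS
      (fun hb => hZ0 (by rw [hb, map_zero])) hZ
    rintro _ ⟨c, hc, rfl⟩
    -- Near `1` every element of `SO(3,k)` is the exponential of an infinitesimal isometry, now
    -- known to be tangent to `S`.
    refine Subgroup.subset_of_isPreconnected (H := S) (K := indefSO 3 k) ?_
      (isPreconnected_connectedComponent.image _ continuous_subtype_val.continuousOn)
      ?_ ⟨1, mem_connectedComponent, rfl⟩ ⟨c, hc, rfl⟩
    · filter_upwards [(tendsto_mul_val_mul hRP).eventually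
        (eventually_exists_exp_eq (splitForm_mul_self k) univ_mem)] with g hg hgG
      obtain ⟨X, hX, -, hXg⟩ := hg (hP.transpose_mul_splitForm_mul hPR hgG)
      rw [← mul_mul_mem_conjSubmonoid_iff hPR hRP, ← hXg]
      have h1 := hall hX 1
      rwa [one_smul] at h1
    · rintro _ ⟨g, -, rfl⟩
      exact g.2
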